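/- Let $u:[0,1]\to\mathbb{R}$ be a continuous function with $u\ge 0$ and $u(t_0)=0$ for some $t_0\in[0,1]$, and put $u_{\max}=\max_{t\in[0,1]}u(t)$. Let $k\in L_2([0,1]^2)$ be a complex-valued kernel (with respect to Lebesgue measure) such that $k(t,s)=\overline{k(s,t)}$ for almost every $(t,s)$. On the complex Hilbert space $L_2[0,1]$ consider the bounded self-adjoint operators $$(Uf)(t)=u(t)f(t),\qquad (Kf)(t)=\int_0^1 k(t,s)f(s)\,ds,\qquad H=U-K .$$ For a bounded self-adjoint operator $A$ let the discrete spectrum $\sigma_d(A)$ be the set of isolated points of the spectrum $\sigma(A)$ that are eigenvalues of finite multiplicity, and let $\sigma_e(A)=\sigma(A)\setminus\sigma_d(A)$ be the essential spectrum. Then $\sigma_e(H)=[0,u_{\max}]$, and: (a) if $K$ has only finitely many positive eigenvalues, then $H$ has only finitely many eigenvalues, counted with multiplicity, lying below $\sigma_e(H)$; (b) if $K$ has only finitely many negative eigenvalues, then $H$ has only finitely many eigenvalues, counted with multiplicity, lying above $\sigma_e(H)$. -/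

import Mathlib

open MeasureTheory unitInterval
open scoped ENNReal ComplexConjugate

noncomputable section

namespace Friedrichs

/-- The complex Hilbert space `L₂[0,1]` (Lebesgue measure). -/
abbrev L2I : Type := Lp ℂ 2 (volume : Measure I)

/-- The complex Hilbert space `L₂([0,1]²)` (Lebesgue measure), the space of kernels. -/
abbrev L2Sq : Type := Lp ℂ 2 (volume : Measure (I × I))

/-! ### The multiplication operator -/

/-- A real continuous function on `[0,1]`, viewed as an element of `L_∞[0,1]`. -/
def toLinfty (u : C(I, ℝ)) : Lp ℂ ∞ (volume : Measure I) :=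
  ContinuousMap.toLp ∞ volume ℂ (⟨fun t => (u t : ℂ), by fun_prop⟩ : C(I, ℂ))

/-- The bounded operator `U` on `L₂[0,1]`, `(U f)(t) = u(t) f(t)`. -/
def mulOp (u : C(I, ℝ)) : L2I →L[ℂ] L2I :=
  (ContinuousLinearMap.mul ℂ ℂ).holderL volume ∞ 2 2 (toLinfty u)

theorem mulOp_apply (u : C(I, ℝ)) (f : L2I) :
    mulOp u f =ᵐ[volume] fun t => (u t : ℂ) * f t := by
  have h1 : mulOp u f =ᵐ[volume] fun t => (toLinfty u) t * f t :=
    (ContinuousLinearMap.mul ℂ ℂ).coeFn_holder (r := 2) (toLinfty u) f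
  have h2 : (toLinfty u) =ᵐ[volume] fun t => (u t : ℂ) :=
    ContinuousMap.coeFn_toLp (p := ∞) (𝕜 := ℂ) volume
      (⟨fun t => (u t : ℂ), by fun_prop⟩ : C(I, ℂ))
  filter_upwards [h1, h2] with t ht1 ht2
  rw [ht1, ht2]

/-! ### The integral operator with an `L₂` kernel -/

/-- The function `t ↦ ∫₀¹ k(t,s) f(s) ds`. -/
def integralFun (k : L2Sq) (f : L2I) (t : I) : ℂ := ∫ s, k (t, s) * f s

theorem eLpNorm_two_sq {α : Type*} [MeasurableSpace α] (μ : Measure α) (g : α → ℂ) :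
    eLpNorm g 2 μ = (∫⁻ x, ‖g x‖ₑ ^ (2 : ℝ) ∂μ) ^ (1 / 2 : ℝ) := by
  rw [eLpNorm_eq_lintegral_rpow_enorm_toReal (by norm_num) (by norm_num)]
  norm_num

theorem aestronglyMeasurable_kernel_mul (k : L2Sq) (f : L2I) :
    AEStronglyMeasurable (fun p : I × I => k p * f p.2)
      ((volume : Measure I).prod (volume : Measure I)) :=
  (Lp.aestronglyMeasurable k).mul (Lp.aestronglyMeasurable f).comp_snd

theorem eLpNorm_integralFun_le (k : L2Sq) (f : L2I) :
    eLpNorm (integralFun k f) 2 volume ≤ eLpNorm k 2 volume * eLpNorm f 2 volume := by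
  have hk : AEStronglyMeasurable (k : I × I → ℂ)
      ((volume : Measure I).prod (volume : Measure I)) := Lp.aestronglyMeasurable k
  have hf : AEStronglyMeasurable (f : I → ℂ) volume := Lp.aestronglyMeasurable f
  have key : ∀ᵐ t : I, ‖integralFun k f t‖ₑ ^ (2 : ℝ) ≤
      (∫⁻ s, ‖k (t, s)‖ₑ ^ (2 : ℝ)) * ∫⁻ s, ‖f s‖ₑ ^ (2 : ℝ) := by
    filter_upwards [hk.prodMk_left] with t ht
    have h1 : ‖integralFun k f t‖ₑ ≤ ∫⁻ s, ‖k (t, s)‖ₑ * ‖f s‖ₑ := by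
      refine (enorm_integral_le_lintegral_enorm _).trans (le_of_eq ?_)
      simp only [enorm_mul]
    have h2 := ENNReal.lintegral_mul_le_Lp_mul_Lq (volume : Measure I)
      Real.HolderConjugate.two_two ht.enorm hf.enorm
    calc ‖integralFun k f t‖ₑ ^ (2 : ℝ)
        ≤ ((∫⁻ s, ‖k (t, s)‖ₑ ^ (2 : ℝ)) ^ (1 / 2 : ℝ) *
            (∫⁻ s, ‖f s‖ₑ ^ (2 : ℝ)) ^ (1 / 2 : ℝ)) ^ (2 : ℝ) :=
          ENNReal.rpow_le_rpow (h1.trans h2) (by norm_num)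
      _ = _ := by
          rw [ENNReal.mul_rpow_of_nonneg _ _ (by norm_num), ← ENNReal.rpow_mul,
            ← ENNReal.rpow_mul]
          norm_num
  rw [eLpNorm_two_sq, eLpNorm_two_sq, eLpNorm_two_sq,
    ← ENNReal.mul_rpow_of_nonneg _ _ (by norm_num)]
  refine ENNReal.rpow_le_rpow ?_ (by norm_num)
  calc ∫⁻ t, ‖integralFun k f t‖ₑ ^ (2 : ℝ)
      ≤ ∫⁻ t, (∫⁻ s, ‖k (t, s)‖ₑ ^ (2 : ℝ)) * ∫⁻ s, ‖f s‖ₑ ^ (2 : ℝ) :=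
        lintegral_mono_ae key
    _ = (∫⁻ t, ∫⁻ s, ‖k (t, s)‖ₑ ^ (2 : ℝ)) * ∫⁻ s, ‖f s‖ₑ ^ (2 : ℝ) :=
        lintegral_mul_const'' _ ((hk.enorm.pow_const _).lintegral_prod_right')
    _ = _ := by
        congr 1
        exact (lintegral_prod _ (hk.enorm.pow_const _)).symm

theorem memLp_integralFun (k : L2Sq) (f : L2I) : MemLp (integralFun k f) 2 volume :=
  ⟨(aestronglyMeasurable_kernel_mul k f).integral_prod_right',
    (eLpNorm_integralFun_le k f).trans_lt
      (ENNReal.mul_lt_top (Lp.eLpNorm_lt_top k) (Lp.eLpNorm_lt_top f))⟩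

theorem integrable_kernel_mul (k : L2Sq) (f : L2I) :
    ∀ᵐ t : I, Integrable (fun s => k (t, s) * f s) := by
  have h : Integrable (fun p : I × I => k p * f p.2)
      ((volume : Measure I).prod (volume : Measure I)) :=
    MemLp.integrable_mul (p := 2) (q := 2) (Lp.memLp k) ((Lp.memLp f).comp_snd _)
  exact h.prod_right_ae

/-- The bounded integral operator `K` on `L₂[0,1]` with kernel `k ∈ L₂([0,1]²)`,
`(K f)(t) = ∫₀¹ k(t,s) f(s) ds`. -/
def integralOp (k : L2Sq) : L2I →L[ℂ] L2I :=
  LinearMap.mkContinuous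
    { toFun := fun f => (memLp_integralFun k f).toLp (integralFun k f)
      map_add' := fun f g => by
        rw [← MemLp.toLp_add]
        refine MemLp.toLp_congr _ _ ?_
        filter_upwards [integrable_kernel_mul k f, integrable_kernel_mul k g] with t hf hg
        simp only [integralFun, Pi.add_apply]
        rw [← integral_add hf hg]
        refine integral_congr_ae ?_
        filter_upwards [Lp.coeFn_add f g] with s hs
        rw [hs, Pi.add_apply, mul_add]
      map_smul' := fun c f => by
        rw [RingHom.id_apply, ← MemLp.toLp_const_smul]
        refine MemLp.toLp_congr _ _ (Filter.Eventually.of_forall fun t => ?_)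
        simp only [integralFun, Pi.smul_apply, smul_eq_mul]
        rw [← integral_const_mul]
        refine integral_congr_ae ?_
        filter_upwards [Lp.coeFn_smul c f] with s hs
        rw [hs, Pi.smul_apply, smul_eq_mul]
        ring }
    ‖k‖ (fun f => by
      simp only [LinearMap.coe_mk, AddHom.coe_mk]
      rw [Lp.norm_toLp, Lp.norm_def, Lp.norm_def, ← ENNReal.toReal_mul]
      exact ENNReal.toReal_mono
        (ENNReal.mul_lt_top (Lp.eLpNorm_lt_top k) (Lp.eLpNorm_lt_top f)).ne
        (eLpNorm_integralFun_le k f))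

theorem integralOp_apply (k : L2Sq) (f : L2I) :
    integralOp k f =ᵐ[volume] fun t => ∫ s, k (t, s) * f s :=
  MemLp.coeFn_toLp (memLp_integralFun k f)

/-- The operator `H = U - K` of the Friedrichs model. -/
def hamiltonian (u : C(I, ℝ)) (k : L2Sq) : L2I →L[ℂ] L2I := mulOp u - integralOp k

/-! ### Spectral notions for bounded self-adjoint operators -/

variable {E : Type*} [NormedAddCommGroup E] [InnerProductSpace ℂ E] [CompleteSpace E]

/-- `z` is an eigenvalue of the bounded operator `A`. -/
def IsEigenvalue (A : E →L[ℂ] E) (z : ℂ) : Prop :=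
  Module.End.HasEigenvalue (A : E →ₗ[ℂ] E) z

/-- The discrete spectrum of a self-adjoint operator: the isolated points of the spectrum that
are eigenvalues of finite multiplicity. -/
def discreteSpectrum (A : E →L[ℂ] E) : Set ℂ :=
  {z | z ∈ spectrum ℂ A ∧ (∃ ε > 0, spectrum ℂ A ∩ Metric.ball z ε = {z}) ∧
    IsEigenvalue A z ∧ FiniteDimensional ℂ (Module.End.eigenspace (A : E →ₗ[ℂ] E) z)}

/-- The essential spectrum of a self-adjoint operator: the complement of the discrete spectrum
in the spectrum. -/
def essentialSpectrum (A : E →L[ℂ] E) : Set ℂ := spectrum ℂ A \ discreteSpectrum A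

/-- The real numbers lying below (strictly to the left of) the essential spectrum of `A`. -/
def belowEssentialSpectrum (A : E →L[ℂ] E) : Set ℝ := {x | ∀ z ∈ essentialSpectrum A, x < z.re}

/-- The real numbers lying above (strictly to the right of) the essential spectrum of `A`. -/
def aboveEssentialSpectrum (A : E →L[ℂ] E) : Set ℝ := {x | ∀ z ∈ essentialSpectrum A, z.re < x}

/-- The set `S` of reals contains only finitely many eigenvalues of `A`, counted with
multiplicity: finitely many distinct ones, each with a finite-dimensional eigenspace. -/
def FinitelyManyEigenvaluesIn (A : E →L[ℂ] E) (S : Set ℝ) : Prop :=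
  {x : ℝ | x ∈ S ∧ IsEigenvalue A (x : ℂ)}.Finite ∧
    ∀ x ∈ S, FiniteDimensional ℂ (Module.End.eigenspace (A : E →ₗ[ℂ] E) (x : ℂ))

end Friedrichs

end

open MeasureTheory unitInterval
open scoped ENNReal ComplexConjugate

/-!
The operator `H = U - K` is a compact self-adjoint perturbation of the multiplication operator `U`,
whose spectrum is the range of `u`, that is `[0, u_max]`.

*Essential spectrum.* The inclusion `σ_e(H) ⊆ σ(U)` (`essentialSpectrum_sub_subset`) rests on the
Fredholm alternative: for `z ∉ σ(U)` the operator `z - H = (z - U) + K` is invertible as soon as it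
is injective, so points of `σ(H)` outside `σ(U)` are eigenvalues. Such a `z` is isolated: if `P` is
the orthogonal projection onto `ker (H - z)`, then `z - H - P` is invertible, hence so is
`w - H - P` for `w` near `z`; but an eigenvector of `H` for `w ≠ z` is killed by `P`, and would
therefore be killed by `w - H - P`.
Conversely (`mem_essentialSpectrum_sub_of_orthonormal`), if `z ∉ σ_e(H)`, the functional calculus
provides `B` and a compact `C` with `B (H - z) = 1 - C`. Since `K` is compact, `B (U - z)` is then
also a compact perturbation of the identity, which is impossible when there are orthonormal
sequences that `U - z` makes uniformly as small as desired. For `z = u t₀` these are normalised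
indicators of disjoint open sets near `t₀`.

*Finiteness.* If `K` has finitely many positive eigenvalues, then `K ≤ 0` on the orthogonal
complement of a finite-dimensional space `V`, so that `H ≥ 0` there. On the span of the eigenvectors
of `H` with negative eigenvalue the quadratic form of `H` is negative definite, so the orthogonal
projection onto `V` is injective on that span (`finitelyManyEigenvaluesIn_Iio`). The statement about
eigenvalues above `σ_e(H)` follows by passing to `-H = (-U) - (-K)`.

Compactness of `K` (`isCompactOperator_integralOp`) comes from the density of degenerate kernels in
`L₂([0,1]²)`.
-/

namespace Friedrichs

section Abstract

/-! ### Compact operators and the Fredholm alternative -/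

variable {E : Type*} [NormedAddCommGroup E] [InnerProductSpace ℂ E]

theorem mem_eigenspace_clm_iff {A : E →L[ℂ] E} {z : ℂ} {f : E} :
    f ∈ Module.End.eigenspace (A : E →ₗ[ℂ] E) z ↔ A f = z • f :=
  Module.End.mem_eigenspace_iff

theorem isEigenvalue_iff {A : E →L[ℂ] E} {z : ℂ} :
    IsEigenvalue A z ↔ ∃ f, f ≠ 0 ∧ A f = z • f := by
  constructor
  · intro h
    obtain ⟨f, hf⟩ := Module.End.HasEigenvalue.exists_hasEigenvector h
    exact ⟨f, hf.2, hf.apply_eq_smul⟩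
  · rintro ⟨f, hf, h⟩
    exact Module.End.hasEigenvalue_of_hasEigenvector (x := f)
      ⟨mem_eigenspace_clm_iff.2 h, hf⟩

theorem isCompactOperator_of_forall_mem {T : E →L[ℂ] E} (V : Submodule ℂ E)
    [FiniteDimensional ℂ V] (h : ∀ f, T f ∈ V) : IsCompactOperator T := by
  have := FiniteDimensional.proper ℂ V
  exact (isCompactOperator_of_locallyCompactSpace_dom (T.codRestrict V h)).clm_comp V.subtypeL

/-- A compact operator cannot separate the members of an orthonormal sequence. -/
theorem exists_norm_map_sub_lt {f : ℕ → E} (hf : Orthonormal ℂ f) {C : E →L[ℂ] E}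
    (hC : IsCompactOperator C) {δ : ℝ} (hδ : 0 < δ) : ∃ n m, n ≠ m ∧ ‖C (f n - f m)‖ < δ := by
  obtain ⟨S, hS, hCS⟩ :=
    IsCompactOperator.image_closedBall_subset_compact (f := (C : E →ₗ[ℂ] E)) hC 1
  obtain ⟨y, -, φ, hφ, hy⟩ := hS.tendsto_subseq (x := fun n => C (f n))
    fun n => hCS ⟨f n, by simp [hf.1 n], rfl⟩
  obtain ⟨N, hN⟩ := Metric.cauchySeq_iff'.1 hy.cauchySeq δ hδ
  refine ⟨φ (N + 1), φ N, hφ.injective.ne (by simp), ?_⟩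
  simpa [dist_eq_norm] using hN (N + 1) (by simp)

variable [CompleteSpace E]

/-- Fredholm alternative: an injective compact perturbation of an invertible operator is
invertible. -/
theorem isUnit_sub_of_isCompactOperator {S C : E →L[ℂ] E} (hS : IsUnit S)
    (hC : IsCompactOperator C) (hinj : ∀ f, S f = C f → f = 0) : IsUnit (S - C) := by
  obtain ⟨R, hSR, -⟩ := isUnit_iff_exists.1 hS
  have hRC : IsCompactOperator (R * C : E →L[ℂ] E) := hC.clm_comp R
  have h1 : (1 : ℂ) ∈ resolventSet ℂ (R * C : E →L[ℂ] E) := by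
    refine (hRC.hasEigenvalue_or_mem_resolventSet one_ne_zero).resolve_left fun h => ?_
    obtain ⟨f, hf⟩ := h.exists_hasEigenvector
    have h2 : R (C f) = f := by simpa using hf.apply_eq_smul
    refine hf.2 (hinj f ?_)
    conv_lhs => rw [← h2]
    exact congrArg (fun T : E →L[ℂ] E => T (C f)) hSR
  rw [spectrum.mem_resolventSet_iff, map_one] at h1
  convert hS.mul h1 using 1
  rw [mul_sub, mul_one, ← mul_assoc, hSR, one_mul]

/-- If `R` inverts `z - U`, the compact operator `-R K` is the identity on the eigenspace of `U - K`
at `z`. -/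
theorem finiteDimensional_eigenspace_sub {U K : E →L[ℂ] E} (hK : IsCompactOperator K) {z : ℂ}
    (hz : z ∉ spectrum ℂ U) :
    FiniteDimensional ℂ (Module.End.eigenspace ((U - K : E →L[ℂ] E) : E →ₗ[ℂ] E) z) := by
  rw [spectrum.notMem_iff] at hz
  obtain ⟨R, -, hR⟩ := isUnit_iff_exists.1 hz
  have hC : IsCompactOperator (-(R * K) : E →L[ℂ] E) := (hK.clm_comp R).neg
  set V := Module.End.eigenspace ((U - K : E →L[ℂ] E) : E →ₗ[ℂ] E) z
  have hCV : ∀ f ∈ V, (-(R * K) : E →L[ℂ] E) f = f := by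
    intro f hf
    have h1 : U f - K f = z • f := mem_eigenspace_clm_iff.1 hf
    have h2 : R (z • f - U f) = f := by
      have := congrArg (fun T : E →L[ℂ] E => T f) hR
      simpa [Algebra.algebraMap_eq_smul_one] using this
    rw [← h1] at h2
    simpa using h2
  have hmem : ∀ f ∈ V, ((-(R * K) : E →L[ℂ] E) : E →ₗ[ℂ] E) f ∈ V := fun f hf => by
    have : ((-(R * K) : E →L[ℂ] E) : E →ₗ[ℂ] E) f = f := hCV f hf
    rwa [this]
  have h := IsCompactOperator.restrict' (f := ((-(R * K) : E →L[ℂ] E) : E →ₗ[ℂ] E)) hC hmem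
  refine FiniteDimensional.of_isCompactOperator_id ?_
  convert! h using 1
  exact funext fun f => Subtype.ext (hCV f f.2).symm

theorem mem_spectrum_sub_iff_isEigenvalue {U K : E →L[ℂ] E} (hK : IsCompactOperator K) {z : ℂ}
    (hz : z ∉ spectrum ℂ U) : z ∈ spectrum ℂ (U - K) ↔ IsEigenvalue (U - K) z := by
  constructor
  · intro h
    by_contra hev
    rw [isEigenvalue_iff] at hev
    rw [spectrum.notMem_iff] at hz
    refine h ?_
    rw [spectrum.mem_resolventSet_iff]
    have := isUnit_sub_of_isCompactOperator (C := -K) hz hK.neg fun f hf => by_contra fun hf0 =>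
      hev ⟨f, hf0, ?_⟩
    · convert this using 1
      abel
    · have hf' : z • f - U f = - K f := by
        simpa [Algebra.algebraMap_eq_smul_one] using hf
      change U f - K f = z • f
      rw [← sub_eq_zero, ← neg_eq_zero, ← sub_eq_zero.2 hf']
      abel
  · intro h
    rw [ContinuousLinearMap.spectrum_eq]
    exact Module.End.HasEigenvalue.mem_spectrum h

/-! ### Stability of the essential spectrum -/

theorem inner_eq_zero_of_eigenvectors {A : E →L[ℂ] E} (hA : IsSelfAdjoint A) {z w : ℂ}
    (hzw : z ≠ w) {f g : E} (hf : A f = z • f) (hg : A g = w • g) : inner ℂ f g = 0 :=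
  hA.isSymmetric.orthogonalFamily_eigenspaces hzw ⟨f, mem_eigenspace_clm_iff.2 hf⟩
    ⟨g, mem_eigenspace_clm_iff.2 hg⟩

/-- One half of Weyl's theorem: a compact self-adjoint perturbation creates no essential spectrum
outside the spectrum of the unperturbed operator. -/
theorem essentialSpectrum_sub_subset {U K : E →L[ℂ] E} (hU : IsSelfAdjoint U)
    (hKs : IsSelfAdjoint K) (hK : IsCompactOperator K) :
    essentialSpectrum (U - K) ⊆ spectrum ℂ U := by
  rintro z ⟨hzs, hzd⟩
  by_contra hz
  refine hzd ⟨hzs, ?_, (mem_spectrum_sub_iff_isEigenvalue hK hz).1 hzs,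
    finiteDimensional_eigenspace_sub hK hz⟩
  have hH : IsSelfAdjoint (U - K) := hU.sub hKs
  have := finiteDimensional_eigenspace_sub hK hz
  set V := Module.End.eigenspace ((U - K : E →L[ℂ] E) : E →ₗ[ℂ] E) z
  let P : E →L[ℂ] E := V.starProjection
  have hP : IsCompactOperator P :=
    isCompactOperator_of_forall_mem V V.starProjection_apply_mem
  have hPz : ∀ f, (U - K) (P f) = z • P f := fun f =>
    mem_eigenspace_clm_iff.1 (V.starProjection_apply_mem f)
  have hzr : conj z = z := hH.isSymmetric.conj_eigenvalue_eq_self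
    ((mem_spectrum_sub_iff_isEigenvalue hK hz).1 hzs)
  -- injectivity suffices, because `K - P` is compact
  have hunit : IsUnit (algebraMap ℂ (E →L[ℂ] E) z - (U - K) - P) := by
    have := isUnit_sub_of_isCompactOperator (C := P - K) (spectrum.notMem_iff.1 hz) (hP.sub hK)
      (fun f hf => ?_)
    · convert this using 1
      abel
    have hf' : z • f - (U - K) f = P f := by
      have h : z • f - U f = P f - K f := by
        simpa [Algebra.algebraMap_eq_smul_one] using hf
      rw [← sub_add_cancel (P f) (K f), ← h, sub_apply]
      abel
    -- `z` is real, so the range of `z - (U - K)` is orthogonal to its kernel, the range of `P`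
    have hPf : P f = 0 := by
      have h1 : inner ℂ (P f) (P f) = 0 := by
        have h2 : inner ℂ (P f) ((U - K) f) = inner ℂ ((U - K) (P f)) f :=
          (hH.isSymmetric (P f) f).symm
        conv_lhs => enter [3]; rw [← hf']
        rw [inner_sub_right, h2, hPz, inner_smul_left, inner_smul_right, hzr, sub_self]
      exact inner_self_eq_zero.1 h1
    have hfV : f ∈ V := by
      rw [hPf, sub_eq_zero] at hf'
      exact mem_eigenspace_clm_iff.2 hf'.symm
    rw [← V.starProjection_eq_self_iff.2 hfV]
    exact hPf
  have hev : ∀ᶠ w in nhds z, w ∉ spectrum ℂ U ∧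
      IsUnit (algebraMap ℂ (E →L[ℂ] E) w - (U - K) - P) := by
    refine Filter.Eventually.and ((spectrum.isClosed U).compl_mem_nhds hz) ?_
    have hc : Continuous fun w : ℂ => algebraMap ℂ (E →L[ℂ] E) w - (U - K) - P := by fun_prop
    exact hc.continuousAt.eventually (Units.isOpen.mem_nhds hunit)
  obtain ⟨ε, hε, hball⟩ := Metric.eventually_nhds_iff_ball.1 hev
  refine ⟨ε, hε, Set.eq_singleton_iff_unique_mem.2 ⟨⟨hzs, Metric.mem_ball_self hε⟩, ?_⟩⟩
  -- an eigenvector for `w ≠ z` is orthogonal to `V`, hence in the kernel of an invertible operator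
  rintro w ⟨hws, hwb⟩
  by_contra hwz
  obtain ⟨f, hf0, hf⟩ := isEigenvalue_iff.1
    ((mem_spectrum_sub_iff_isEigenvalue hK (hball w hwb).1).1 hws)
  have hPf : P f = 0 := by
    refine (V.starProjection_apply_eq_zero_iff).2 fun g hg => ?_
    exact inner_eq_zero_of_eigenvectors hH (Ne.symm hwz) (mem_eigenspace_clm_iff.1 hg) hf
  refine hf0 ((ContinuousLinearMap.isUnit_iff_bijective.1 (hball w hwb).2).1 ?_)
  have h0 : (algebraMap ℂ (E →L[ℂ] E) w - (U - K) - P) f = w • f - (U - K) f - P f := by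
    simp [Algebra.algebraMap_eq_smul_one]
  rw [h0, hf, hPf, map_zero, sub_self, sub_zero]

/-- Off the essential spectrum, `A - z` has a left inverse modulo compact operators. When `z` is an
isolated point of the spectrum, `B` and `C` are the functions `x ↦ (x - z)⁻¹` (extended by `0` at
`z`) and the indicator of `{z}`, evaluated at `A`. -/
theorem exists_mul_eq_one_sub_of_notMem_essentialSpectrum {A : E →L[ℂ] E} (hA : IsSelfAdjoint A)
    {z : ℂ} (hz : z ∉ essentialSpectrum A) :
    ∃ B C : E →L[ℂ] E, IsCompactOperator C ∧
      B * (A - algebraMap ℂ (E →L[ℂ] E) z) = 1 - C := by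
  by_cases hzs : z ∈ spectrum ℂ A
  swap
  · rw [spectrum.notMem_iff, ← IsUnit.neg_iff, neg_sub] at hzs
    obtain ⟨B, -, hB⟩ := isUnit_iff_exists.1 hzs
    exact ⟨B, 0, isCompactOperator_zero, by rw [hB, sub_zero]⟩
  obtain ⟨-, ⟨ε, hε, hiso⟩, -, hfin⟩ : z ∈ discreteSpectrum A := by
    by_contra h
    exact hz ⟨hzs, h⟩
  have hn : IsStarNormal A := hA.isStarNormal
  -- every function which is continuous off `z` is continuous on the spectrum
  have hcont : ∀ (c : ℂ) (g : ℂ → ℂ), ContinuousOn g {z}ᶜ →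
      ContinuousOn (fun x => if x = z then c else g x) (spectrum ℂ A) := by
    intro c g hg x hx
    by_cases hxz : x = z
    · subst hxz
      refine (continuousWithinAt_const (b := c)).congr_of_eventuallyEq ?_ (by simp)
      filter_upwards [self_mem_nhdsWithin, mem_nhdsWithin_of_mem_nhds (Metric.ball_mem_nhds x hε)]
        with y hy hyb
      have : y ∈ spectrum ℂ A ∩ Metric.ball x ε := ⟨hy, hyb⟩
      rw [hiso] at this
      simp [Set.mem_singleton_iff.1 this]
    · have hx' : {z}ᶜ ∈ nhds x := isOpen_compl_singleton.mem_nhds hxz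
      refine ((hg.continuousAt hx').congr ?_).continuousWithinAt
      filter_upwards [hx'] with y hy
      have : y ≠ z := hy
      simp [this]
  let b : ℂ → ℂ := fun x => if x = z then 0 else (x - z)⁻¹
  let p : ℂ → ℂ := fun x => if x = z then 1 else 0
  have hb : ContinuousOn b (spectrum ℂ A) := hcont 0 _
    ((continuousOn_id.sub continuousOn_const).inv₀ fun x hx => sub_ne_zero.2 hx)
  have hp : ContinuousOn p (spectrum ℂ A) := hcont 1 _ continuousOn_const
  have hid : ContinuousOn (fun x : ℂ => x - z) (spectrum ℂ A) := by fun_prop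
  have hAz : cfc (fun x : ℂ => x - z) A = A - algebraMap ℂ (E →L[ℂ] E) z := by
    rw [cfc_sub (fun x => x) (fun _ => z) A, cfc_id' ℂ A, cfc_const z A]
  refine ⟨cfc b A, cfc p A, ?_, ?_⟩
  · set V := Module.End.eigenspace (A : E →ₗ[ℂ] E) z
    have hzero : (A - algebraMap ℂ (E →L[ℂ] E) z) * cfc p A = 0 := by
      rw [← hAz, ← cfc_mul _ _ A hid hp, ← cfc_zero ℂ A]
      refine cfc_congr fun x _ => ?_
      by_cases hx : x = z <;> simp [p, hx]
    have hmem : ∀ f, cfc p A f ∈ V := fun f => by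
      have := congrArg (fun T : E →L[ℂ] E => T f) hzero
      refine mem_eigenspace_clm_iff.2 (sub_eq_zero.1 ?_)
      simpa [Algebra.algebraMap_eq_smul_one] using this
    exact isCompactOperator_of_forall_mem V hmem
  · rw [← hAz, ← cfc_mul _ _ A hb hid, ← cfc_one ℂ A, ← cfc_sub _ _ A (by fun_prop) hp]
    refine cfc_congr fun x _ => ?_
    by_cases hx : x = z
    · simp [b, p, hx]
    · simp [b, p, hx, sub_ne_zero.2 hx]

/-- The other half of Weyl's theorem, in the form of Weyl's criterion: a point with orthonormal
sequences of approximate eigenvectors for `U` is in the essential spectrum of `U - K`. -/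
theorem mem_essentialSpectrum_sub_of_orthonormal {U K : E →L[ℂ] E} (hU : IsSelfAdjoint U)
    (hKs : IsSelfAdjoint K) (hK : IsCompactOperator K) {z : ℂ}
    (h : ∀ ε > 0, ∃ f : ℕ → E, Orthonormal ℂ f ∧ ∀ n, ‖U (f n) - z • f n‖ ≤ ε) :
    z ∈ essentialSpectrum (U - K) := by
  by_contra hz
  obtain ⟨B, C, hC, hBC⟩ := exists_mul_eq_one_sub_of_notMem_essentialSpectrum (hU.sub hKs) hz
  have hD : IsCompactOperator (C - B * K : E →L[ℂ] E) := hC.sub (hK.clm_comp B)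
  have hid : ∀ f, f = (C - B * K) f + B (U f - z • f) := by
    intro f
    have h1 := congrArg (fun T : E →L[ℂ] E => T f) hBC
    have h2 : B (U f - K f - z • f) = f - C f := by
      simpa [Algebra.algebraMap_eq_smul_one] using h1
    have h3 : U f - K f - z • f = (U f - z • f) - K f := by abel
    rw [h3, map_sub] at h2
    change f = C f - B (K f) + B (U f - z • f)
    rw [sub_eq_iff_eq_add.1 h2]
    abel
  obtain ⟨f, hf, hfU⟩ := h (1 / (4 * (‖B‖ + 1))) (by positivity)
  obtain ⟨n, m, hnm, hlt⟩ := exists_norm_map_sub_lt hf hD (δ := 1 / 2) (by norm_num)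
  have hB : ∀ n, ‖B (U (f n) - z • f n)‖ ≤ 1 / 4 := fun n => by
    refine (B.le_opNorm _).trans ?_
    calc ‖B‖ * ‖U (f n) - z • f n‖ ≤ (‖B‖ + 1) * (1 / (4 * (‖B‖ + 1))) := by
          gcongr
          · linarith
          · exact hfU n
      _ = 1 / 4 := by field_simp
  -- this contradicts orthonormality, which gives `‖f n - f m‖ ^ 2 = 2`
  have h1 : ‖f n - f m‖ < 1 := by
    have h2 : f n - f m = (C - B * K) (f n - f m) +
        (B (U (f n) - z • f n) - B (U (f m) - z • f m)) := by
      rw [map_sub]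
      conv_lhs => rw [hid (f n), hid (f m)]
      abel
    rw [h2]
    have := norm_add_le ((C - B * K) (f n - f m))
      (B (U (f n) - z • f n) - B (U (f m) - z • f m))
    have h3 := norm_sub_le (B (U (f n) - z • f n)) (B (U (f m) - z • f m))
    linarith [hB n, hB m]
  have h4 : ‖f n - f m‖ ^ 2 = 2 := by
    rw [@norm_sub_sq ℂ, hf.1, hf.1, hf.2 hnm]
    norm_num
  nlinarith [norm_nonneg (f n - f m)]

end Abstract

section Finiteness

/-! ### Finiteness of the number of eigenvalues -/

variable {E : Type*} [NormedAddCommGroup E] [InnerProductSpace ℂ E]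

/-- Eigenvectors for distinct eigenvalues are linearly independent, so a finite-dimensional space
contains only finitely many of them. -/
theorem FinitelyManyEigenvaluesIn.of_eigenspace_le {A : E →L[ℂ] E} {S : Set ℝ} (W : Submodule ℂ E)
    [FiniteDimensional ℂ W]
    (h : ∀ x ∈ S, Module.End.eigenspace (A : E →ₗ[ℂ] E) (x : ℂ) ≤ W) :
    FinitelyManyEigenvaluesIn A S := by
  refine ⟨?_, fun x hx => Submodule.finiteDimensional_of_le (h x hx)⟩
  have hex : ∀ x : {x : ℝ | x ∈ S ∧ IsEigenvalue A (x : ℂ)},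
      ∃ f, Module.End.HasEigenvector (A : E →ₗ[ℂ] E) ((x : ℝ) : ℂ) f :=
    fun x => Module.End.HasEigenvalue.exists_hasEigenvector x.2.2
  choose v hv using hex
  have hli : LinearIndependent ℂ v := Module.End.eigenvectors_linearIndependent' _ _
    (Complex.ofReal_injective.comp Subtype.coe_injective) v hv
  have hli' : LinearIndependent ℂ fun x => (⟨v x, h x x.2.1 (hv x).1⟩ : W) :=
    LinearIndependent.of_comp W.subtype hli
  exact Set.finite_coe_iff.1 hli'.finite

theorem FinitelyManyEigenvaluesIn.mono {A : E →L[ℂ] E} {S T : Set ℝ} (hST : S ⊆ T)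
    (h : FinitelyManyEigenvaluesIn A T) : FinitelyManyEigenvaluesIn A S :=
  ⟨h.1.subset fun _ hx => ⟨hST hx.1, hx.2⟩, fun x hx => h.2 x (hST hx)⟩

theorem isEigenvalue_neg_iff {A : E →L[ℂ] E} {z : ℂ} :
    IsEigenvalue (-A) z ↔ IsEigenvalue A (-z) := by
  simp only [isEigenvalue_iff, neg_apply, neg_smul, neg_eq_iff_eq_neg]

theorem eigenspace_neg {A : E →L[ℂ] E} {z : ℂ} :
    Module.End.eigenspace ((-A : E →L[ℂ] E) : E →ₗ[ℂ] E) z =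
      Module.End.eigenspace (A : E →ₗ[ℂ] E) (-z) := by
  ext f
  simp only [mem_eigenspace_clm_iff, neg_apply, neg_smul, neg_eq_iff_eq_neg]

theorem FinitelyManyEigenvaluesIn.of_neg {A : E →L[ℂ] E} {S : Set ℝ}
    (h : FinitelyManyEigenvaluesIn (-A) (-S)) : FinitelyManyEigenvaluesIn A S := by
  refine ⟨?_, fun x hx => ?_⟩
  · convert h.1.neg using 1
    ext x
    simp [isEigenvalue_neg_iff]
  · have := h.2 (-x) (by simpa using hx)
    rwa [eigenspace_neg, Complex.ofReal_neg, neg_neg] at this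

/-- On the span of the eigenvectors with eigenvalue below `c`, the quadratic form of a symmetric
operator is smaller than `c`, by orthogonality of the eigenspaces. -/
theorem re_inner_map_self_lt {A : E →L[ℂ] E} (hA : (A : E →ₗ[ℂ] E).IsSymmetric) {c : ℝ} {f : E}
    (hf : f ∈ ⨆ x : Set.Iio c, Module.End.eigenspace (A : E →ₗ[ℂ] E) ((x : ℝ) : ℂ)) (hf0 : f ≠ 0) :
    (inner ℂ f (A f)).re < c * ‖f‖ ^ 2 := by
  classical
  obtain ⟨v, rfl⟩ := (Submodule.mem_iSup_iff_exists_dfinsupp' _ _).1 hf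
  have horth : OrthogonalFamily ℂ
      (fun x : Set.Iio c => Module.End.eigenspace (A : E →ₗ[ℂ] E) ((x : ℝ) : ℂ))
      fun x => (Module.End.eigenspace (A : E →ₗ[ℂ] E) ((x : ℝ) : ℂ)).subtypeₗᵢ :=
    hA.orthogonalFamily_eigenspaces.comp (Complex.ofReal_injective.comp Subtype.coe_injective)
  have hsum : (v.sum fun _ xi => (xi : E)) = ∑ x ∈ v.support, (v x : E) := rfl
  have hAsum : A (v.sum fun _ xi => (xi : E)) = ∑ x ∈ v.support, ((x : ℝ) : ℂ) • (v x : E) := by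
    rw [hsum, map_sum]
    refine Finset.sum_congr rfl fun x _ => mem_eigenspace_clm_iff.1 (v x).2
  have h1 := horth.inner_sum v (fun x => ((x : ℝ) : ℂ) • v x) v.support
  have h2 := horth.norm_sum v v.support
  simp only [Submodule.coe_subtypeₗᵢ, Submodule.coe_subtype, Submodule.coe_smul] at h1 h2
  rw [hAsum, hsum, h2, h1, Complex.re_sum, Finset.mul_sum]
  have hne : v.support.Nonempty := by
    rw [Finset.nonempty_iff_ne_empty]
    intro h
    rw [hsum, h] at hf0
    simp at hf0
  refine Finset.sum_lt_sum_of_nonempty hne fun x hx => ?_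
  have hx0 : v x ≠ 0 := by simpa using hx
  have h3 : (inner ℂ (v x) (((x : ℝ) : ℂ) • v x)).re = (x : ℝ) * ‖v x‖ ^ 2 := by
    rw [inner_smul_right, Complex.re_ofReal_mul]
    congr 1
    exact inner_self_eq_norm_sq (𝕜 := ℂ) (v x)
  rw [h3]
  have : 0 < ‖v x‖ := norm_pos_iff.2 hx0
  exact mul_lt_mul_of_pos_right x.2 (by positivity)

/-- If the quadratic form of `A` is at least `c` on a subspace of finite codimension, then `A` has
only finitely many eigenvalues below `c`. -/
theorem finitelyManyEigenvaluesIn_Iio {A : E →L[ℂ] E} (hA : (A : E →ₗ[ℂ] E).IsSymmetric) {c : ℝ}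
    (V : Submodule ℂ E) [FiniteDimensional ℂ V]
    (h : ∀ f ∈ Vᗮ, c * ‖f‖ ^ 2 ≤ (inner ℂ f (A f)).re) :
    FinitelyManyEigenvaluesIn A (Set.Iio c) := by
  set W := ⨆ x : Set.Iio c, Module.End.eigenspace (A : E →ₗ[ℂ] E) ((x : ℝ) : ℂ) with hW
  -- a vector of `W` orthogonal to `V` would violate one of the two bounds on the quadratic form
  have hinj : Function.Injective (V.orthogonalProjectionOnto.toLinearMap.domRestrict W) := by
    rw [← LinearMap.ker_eq_bot, LinearMap.ker_eq_bot']
    rintro ⟨f, hfW⟩ hf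
    by_contra hf0
    refine (re_inner_map_self_lt hA hfW fun h0 => hf0 (Subtype.ext h0)).not_ge (h f ?_)
    exact V.orthogonalProjectionOnto_eq_zero_iff.1 hf
  have : FiniteDimensional ℂ W := FiniteDimensional.of_injective _ hinj
  exact .of_eigenspace_le W fun x hx =>
    le_iSup (fun x : Set.Iio c => Module.End.eigenspace (A : E →ₗ[ℂ] E) ((x : ℝ) : ℂ)) ⟨x, hx⟩

variable [CompleteSpace E]

/-- A nonzero point of the spectrum of a compact operator is an eigenvalue, so without positive
eigenvalues the spectrum is nonpositive. -/
theorem re_inner_map_self_nonpos {K : E →L[ℂ] E} (hKs : IsSelfAdjoint K) (hK : IsCompactOperator K)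
    (h : ∀ x : ℝ, 0 < x → ¬ IsEigenvalue K (x : ℂ)) (f : E) : (inner ℂ f (K f)).re ≤ 0 := by
  have h0 : 0 ≤ -K := by
    refine (StarOrderedRing.nonneg_iff_spectrum_nonneg (R := ℝ) (-K) (ha := hKs.neg)).2
      fun x hx => ?_
    by_contra hx0
    push Not at hx0
    refine h (-x) (by linarith) ?_
    have hx' : ((-x : ℝ) : ℂ) ∈ spectrum ℂ K := by
      rw [← spectrum.algebraMap_mem_iff ℂ, ← spectrum.neg_eq] at hx
      simpa using hx
    exact (hK.hasEigenvalue_iff_mem_spectrum (by simpa using hx0.ne)).2 hx'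
  have h1 := (ContinuousLinearMap.nonneg_iff_isPositive _).1 h0
  have h2 := h1.re_inner_nonneg_right f
  simpa using h2

/-- The space `V` is spanned by the eigenvectors of `K` with positive eigenvalue. -/
theorem exists_finiteDimensional_re_inner_nonpos {K : E →L[ℂ] E} (hKs : IsSelfAdjoint K)
    (hK : IsCompactOperator K) (hfin : {x : ℝ | 0 < x ∧ IsEigenvalue K (x : ℂ)}.Finite) :
    ∃ V : Submodule ℂ E, FiniteDimensional ℂ V ∧ ∀ f ∈ Vᗮ, (inner ℂ f (K f)).re ≤ 0 := by
  have := hfin.to_subtype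
  let G : {x : ℝ | 0 < x ∧ IsEigenvalue K (x : ℂ)} → Submodule ℂ E :=
    fun x => Module.End.eigenspace (K : E →ₗ[ℂ] E) ((x : ℝ) : ℂ)
  have hG : ∀ x, FiniteDimensional ℂ (G x) := fun x =>
    ContinuousLinearMap.finite_dimensional_eigenspace hK _ (by simpa using x.2.1.ne')
  refine ⟨⨆ x, G x, inferInstance, ?_⟩
  have hinv : ∀ f ∈ (⨆ x, G x)ᗮ, K f ∈ (⨆ x, G x)ᗮ := by
    intro f hf
    rw [← Submodule.iInf_orthogonal, Submodule.mem_iInf] at hf ⊢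
    exact fun x => hKs.isSymmetric.invariant_orthogonalComplement_eigenspace _ _ (hf x)
  -- the restriction of `K` to the orthogonal complement has no positive eigenvalue left
  let T : (⨆ x, G x)ᗮ →L[ℂ] (⨆ x, G x)ᗮ := K.restrict hinv
  have hTs : IsSelfAdjoint T := by
    rw [ContinuousLinearMap.isSelfAdjoint_iff_isSymmetric]
    exact fun f g => hKs.isSymmetric f g
  have hT : IsCompactOperator T := IsCompactOperator.restrict' (f := (K : E →ₗ[ℂ] E)) hK hinv
  intro f hf
  refine re_inner_map_self_nonpos hTs hT (fun x hx hev => ?_) ⟨f, hf⟩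
  obtain ⟨g, hg0, hg⟩ := isEigenvalue_iff.1 hev
  have hg' : K g = (x : ℂ) • (g : E) := congrArg Subtype.val hg
  have hg0' : (g : E) ≠ 0 := fun h0 => hg0 (Subtype.ext h0)
  have hgG : (g : E) ∈ ⨆ x, G x := le_iSup G ⟨x, hx, isEigenvalue_iff.2 ⟨g, hg0', hg'⟩⟩
    (mem_eigenspace_clm_iff.2 hg')
  exact hg0' (inner_self_eq_zero.1 (g.2 g hgG))

theorem finitelyManyEigenvaluesIn_sub {U K : E →L[ℂ] E} (hU : IsSelfAdjoint U)
    (hKs : IsSelfAdjoint K) (hK : IsCompactOperator K) {c : ℝ}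
    (hc : ∀ f, c * ‖f‖ ^ 2 ≤ (inner ℂ f (U f)).re)
    (hfin : {x : ℝ | 0 < x ∧ IsEigenvalue K (x : ℂ)}.Finite) :
    FinitelyManyEigenvaluesIn (U - K) (Set.Iio c) := by
  obtain ⟨V, hV, hKV⟩ := exists_finiteDimensional_re_inner_nonpos hKs hK hfin
  refine finitelyManyEigenvaluesIn_Iio (hU.sub hKs).isSymmetric V fun f hf => ?_
  rw [sub_apply, inner_sub_right, Complex.sub_re]
  linarith [hc f, hKV f hf]

end Finiteness

/-! ### The integral operator: compactness and self-adjointness -/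

theorem integralOp_add (k l : L2Sq) : integralOp (k + l) = integralOp k + integralOp l := by
  ext1 f
  refine Lp.ext ?_
  have hkl : ∀ᵐ t : I, ∀ᵐ s : I, (k + l) (t, s) = k (t, s) + l (t, s) :=
    Measure.ae_ae_of_ae_prod (Lp.coeFn_add k l)
  rw [add_apply]
  filter_upwards [integralOp_apply (k + l) f, integralOp_apply k f, integralOp_apply l f,
    Lp.coeFn_add (integralOp k f) (integralOp l f), hkl, integrable_kernel_mul k f,
    integrable_kernel_mul l f] with t h1 h2 h3 h4 h5 h6 h7
  rw [h1, h4, Pi.add_apply, h2, h3, ← integral_add h6 h7]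
  refine integral_congr_ae ?_
  filter_upwards [h5] with s hs
  rw [hs, add_mul]

theorem integralOp_smul (c : ℂ) (k : L2Sq) : integralOp (c • k) = c • integralOp k := by
  ext1 f
  refine Lp.ext ?_
  have hk : ∀ᵐ t : I, ∀ᵐ s : I, (c • k) (t, s) = c * k (t, s) :=
    Measure.ae_ae_of_ae_prod (Lp.coeFn_smul c k)
  rw [smul_apply]
  filter_upwards [integralOp_apply (c • k) f, integralOp_apply k f,
    Lp.coeFn_smul c (integralOp k f), hk] with t h1 h2 h3 h4
  rw [h1, h3, Pi.smul_apply, h2, smul_eq_mul, ← integral_const_mul]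
  refine integral_congr_ae ?_
  filter_upwards [h4] with s hs
  rw [hs, mul_assoc]

theorem integralOp_sub (k l : L2Sq) : integralOp (k - l) = integralOp k - integralOp l := by
  rw [sub_eq_add_neg, ← neg_one_smul ℂ l, integralOp_add, integralOp_smul, neg_one_smul,
    ← sub_eq_add_neg]

theorem norm_integralOp_le (k : L2Sq) : ‖integralOp k‖ ≤ ‖k‖ :=
  LinearMap.mkContinuous_norm_le _ (norm_nonneg _) _

theorem continuous_integralOp : Continuous integralOp :=
  (LipschitzWith.of_dist_le' (K := 1) fun k l => by
    rw [dist_eq_norm, dist_eq_norm, ← integralOp_sub, one_mul]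
    exact norm_integralOp_le _).continuous

/-- The kernel `g(t) h(s)` gives the rank-one operator `f ↦ (∫ h f) g`. -/
theorem isCompactOperator_integralOp_toLp_prodMul (g h : C(I, ℂ)) :
    IsCompactOperator (integralOp (ContinuousMap.toLp 2 volume ℂ (ContinuousMap.prodMul g h))) := by
  let v : L2I := ContinuousMap.toLp 2 volume ℂ g
  refine isCompactOperator_of_forall_mem (ℂ ∙ v) fun f =>
    Submodule.mem_span_singleton.2 ⟨∫ s, h s * f s, Lp.ext ?_⟩
  have hk : ∀ᵐ t : I, ∀ᵐ s : I,
      (ContinuousMap.toLp 2 volume ℂ (ContinuousMap.prodMul g h) : L2Sq) (t, s) = g t * h s :=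
    Measure.ae_ae_of_ae_prod (ContinuousMap.coeFn_toLp (p := 2) (𝕜 := ℂ)
      (volume : Measure (I × I)) (ContinuousMap.prodMul g h))
  filter_upwards [integralOp_apply (ContinuousMap.toLp 2 volume ℂ (ContinuousMap.prodMul g h)) f,
    hk, Lp.coeFn_smul (∫ s, h s * f s) v,
    ContinuousMap.coeFn_toLp (p := 2) (𝕜 := ℂ) volume g] with t h1 h2 h3 h4
  rw [h1, h3, Pi.smul_apply, h4, smul_eq_mul, mul_comm, ← integral_const_mul]
  refine integral_congr_ae ?_
  filter_upwards [h2] with s hs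
  rw [hs, mul_assoc]

/-- By the Stone-Weierstrass theorem, continuous functions on the square are uniform limits of
degenerate kernels. -/
theorem dense_span_prodMul :
    Dense (Submodule.span ℂ {c : C(I × I, ℂ) | ∃ g h, c = ContinuousMap.prodMul g h} :
      Set C(I × I, ℂ)) := by
  set S : Set C(I × I, ℂ) := {c | ∃ g h, c = ContinuousMap.prodMul g h} with hS
  have hone : (1 : C(I × I, ℂ)) ∈ Submodule.span ℂ S :=
    Submodule.subset_span ⟨1, 1, by ext; simp⟩
  have hmul : ∀ c d, c ∈ Submodule.span ℂ S → d ∈ Submodule.span ℂ S →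
      c * d ∈ Submodule.span ℂ S := by
    intro c d hc hd
    have h := Submodule.mul_mem_mul hc hd
    rw [Submodule.span_mul_span] at h
    refine Submodule.span_mono ?_ h
    rintro _ ⟨_, ⟨g, h, rfl⟩, _, ⟨g', h', rfl⟩, rfl⟩
    exact ⟨g * g', h * h', by ext; simp [mul_mul_mul_comm]⟩
  have hstar : ∀ {c}, c ∈ Submodule.span ℂ S → star c ∈ Submodule.span ℂ S := by
    intro c hc
    induction hc using Submodule.span_induction with
    | mem c hc =>
      obtain ⟨g, h, rfl⟩ := hc
      exact Submodule.subset_span ⟨star g, star h, by ext; simp⟩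
    | zero => simp
    | add c d _ _ hc hd => rw [star_add]; exact add_mem hc hd
    | smul a c _ hc => rw [star_smul]; exact Submodule.smul_mem _ _ hc
  let A : StarSubalgebra ℂ C(I × I, ℂ) :=
    { (Submodule.span ℂ S).toSubalgebra hone hmul with star_mem' := hstar }
  have hsep : A.SeparatesPoints := by
    intro p q hpq
    let g : C(I, ℂ) := ⟨fun t => ((t : ℝ) : ℂ), by fun_prop⟩
    by_cases h1 : p.1 = q.1
    · have h2 : p.2 ≠ q.2 := fun h2 => hpq (Prod.ext h1 h2)
      refine ⟨_, ⟨ContinuousMap.prodMul 1 g, Submodule.subset_span ⟨1, g, rfl⟩, rfl⟩, ?_⟩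
      simpa [g, Subtype.ext_iff] using h2
    · refine ⟨_, ⟨ContinuousMap.prodMul g 1, Submodule.subset_span ⟨g, 1, rfl⟩, rfl⟩, ?_⟩
      simpa [g, Subtype.ext_iff] using h1
  have htop := ContinuousMap.starSubalgebra_topologicalClosure_eq_top_of_separatesPoints A hsep
  intro c
  have hc : c ∈ A.topologicalClosure := htop ▸ StarSubalgebra.mem_top
  exact hc

theorem isCompactOperator_integralOp (k : L2Sq) : IsCompactOperator (integralOp k) := by
  have hcl : IsClosed {k : L2Sq | IsCompactOperator (integralOp k)} :=
    isClosed_setOfPred_isCompactOperator.preimage continuous_integralOp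
  refine (ContinuousMap.toLp_denseRange (p := 2) ℂ (volume : Measure (I × I)) ℂ
    (by norm_num)).induction_on (p := fun k : L2Sq => IsCompactOperator (integralOp k)) k hcl
    fun c => ?_
  have hcl' : IsClosed {c : C(I × I, ℂ) |
      IsCompactOperator (integralOp (ContinuousMap.toLp 2 volume ℂ c))} :=
    hcl.preimage (ContinuousMap.toLp 2 (volume : Measure (I × I)) ℂ).continuous
  refine hcl'.closure_subset_iff.2 (fun d hd => ?_) (dense_span_prodMul c)
  change IsCompactOperator (integralOp (ContinuousMap.toLp 2 volume ℂ d))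
  induction hd using Submodule.span_induction with
  | mem d hd =>
    obtain ⟨g, h, rfl⟩ := hd
    exact isCompactOperator_integralOp_toLp_prodMul g h
  | zero =>
    rw [map_zero, ← zero_smul ℂ (0 : L2Sq), integralOp_smul, zero_smul]
    exact isCompactOperator_zero
  | add d e _ _ hd he =>
    rw [map_add, integralOp_add]
    exact hd.add he
  | smul a d _ hd =>
    rw [map_smul, integralOp_smul]
    exact hd.smul a

theorem integrable_norm_sq (f : L2I) : Integrable fun t => ‖f t‖ ^ 2 :=
  (memLp_two_iff_integrable_sq_norm (Lp.aestronglyMeasurable f)).1 (Lp.memLp f)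

theorem isSelfAdjoint_integralOp {k : L2Sq}
    (hk : ∀ᵐ p : I × I, k p = conj (k (p.2, p.1))) : IsSelfAdjoint (integralOp k) := by
  rw [ContinuousLinearMap.isSelfAdjoint_iff_isSymmetric]
  intro f g
  change inner ℂ (integralOp k f) g = inner ℂ f (integralOp k g)
  have hint : Integrable (fun p : I × I => conj (k p * f p.2) * g p.1)
      ((volume : Measure I).prod volume) := by
    have h1 : MemLp (fun p : I × I => conj (f p.2) * g p.1) 2
        ((volume : Measure I).prod volume) := by
      refine (memLp_two_iff_integrable_sq_norm ?_).2 ?_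
      · exact (Complex.continuous_conj.comp_aestronglyMeasurable
          (Lp.aestronglyMeasurable f).comp_snd).mul (Lp.aestronglyMeasurable g).comp_fst
      · refine ((integrable_norm_sq g).mul_prod (integrable_norm_sq f)).congr
          (Filter.Eventually.of_forall fun p => ?_)
        simp only [norm_mul, RCLike.norm_conj, mul_pow]
        ring
    have h2 : MemLp (fun p : I × I => conj (k p)) 2 ((volume : Measure I).prod volume) :=
      (Lp.memLp k).star
    refine (h2.integrable_mul h1).congr (Filter.Eventually.of_forall fun p => ?_)
    simp [mul_assoc]
  have hk' : ∀ᵐ s : I, ∀ᵐ t : I, k (s, t) = conj (k (t, s)) := Measure.ae_ae_of_ae_prod hk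
  rw [L2.inner_def, L2.inner_def]
  calc ∫ t, inner ℂ (integralOp k f t) (g t)
      = ∫ t, ∫ s, conj (k (t, s) * f s) * g t := by
        refine integral_congr_ae ?_
        filter_upwards [integralOp_apply k f] with t ht
        rw [ht, RCLike.inner_apply, integral_mul_const, integral_conj, mul_comm]
    _ = ∫ s, ∫ t, conj (k (t, s) * f s) * g t := integral_integral_swap hint
    _ = ∫ s, inner ℂ (f s) (integralOp k g s) := by
        refine integral_congr_ae ?_
        filter_upwards [integralOp_apply k g, hk'] with s hs hks
        rw [hs, RCLike.inner_apply, ← integral_mul_const]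
        refine integral_congr_ae ?_
        filter_upwards [hks] with t ht
        rw [ht, map_mul]
        ring

/-! ### The multiplication operator: quadratic form and spectrum -/

theorem isSelfAdjoint_mulOp (u : C(I, ℝ)) : IsSelfAdjoint (mulOp u) := by
  rw [ContinuousLinearMap.isSelfAdjoint_iff_isSymmetric]
  intro f g
  change inner ℂ (mulOp u f) g = inner ℂ f (mulOp u g)
  rw [L2.inner_def, L2.inner_def]
  refine integral_congr_ae ?_
  filter_upwards [mulOp_apply u f, mulOp_apply u g] with t hf hg
  rw [hf, hg, RCLike.inner_apply, RCLike.inner_apply, map_mul, Complex.conj_ofReal]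
  ring

theorem re_inner_mulOp (u : C(I, ℝ)) (f : L2I) :
    (inner ℂ f (mulOp u f)).re = ∫ t, u t * ‖f t‖ ^ 2 := by
  have h : inner ℂ f (mulOp u f) = ∫ t, ((u t * ‖f t‖ ^ 2 : ℝ) : ℂ) := by
    rw [L2.inner_def]
    refine integral_congr_ae ?_
    filter_upwards [mulOp_apply u f] with t hf
    rw [hf, RCLike.inner_apply, mul_assoc, Complex.mul_conj']
    push_cast
    rfl
  rw [h, integral_complex_ofReal]
  exact Complex.ofReal_re _

theorem mulOp_one : mulOp 1 = 1 := by
  ext1 f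
  refine Lp.ext ?_
  filter_upwards [mulOp_apply 1 f] with t ht
  simp [ht]

theorem norm_sq_eq_integral (f : L2I) : ‖f‖ ^ 2 = ∫ t, ‖f t‖ ^ 2 := by
  have h := re_inner_mulOp 1 f
  rw [mulOp_one, one_apply_eq_self] at h
  simpa [← inner_self_eq_norm_sq (𝕜 := ℂ) f] using h

theorem integrable_mul_norm_sq (u : C(I, ℝ)) (f : L2I) : Integrable fun t => u t * ‖f t‖ ^ 2 :=
  (integrable_norm_sq f).bdd_mul u.continuous.aestronglyMeasurable
    (Filter.Eventually.of_forall u.norm_coe_le_norm)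

theorem mul_norm_sq_le_re_inner_mulOp {u : C(I, ℝ)} {c : ℝ} (h : ∀ t, c ≤ u t) (f : L2I) :
    c * ‖f‖ ^ 2 ≤ (inner ℂ f (mulOp u f)).re := by
  rw [re_inner_mulOp, norm_sq_eq_integral, ← integral_const_mul]
  exact integral_mono ((integrable_norm_sq f).const_mul c) (integrable_mul_norm_sq u f) fun t =>
    mul_le_mul_of_nonneg_right (h t) (by positivity)

theorem mulOp_neg (u : C(I, ℝ)) : mulOp (-u) = -mulOp u := by
  ext1 f
  refine Lp.ext ?_
  rw [neg_apply]
  filter_upwards [mulOp_apply u f, mulOp_apply (-u) f, Lp.coeFn_neg (mulOp u f)] with t h1 h2 h3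
  rw [h2, h3, Pi.neg_apply, h1]
  simp

theorem mulOp_mul_mulOp (u v : C(I, ℝ)) : mulOp u * mulOp v = mulOp (u * v) := by
  ext1 f
  refine Lp.ext ?_
  change mulOp u (mulOp v f) =ᵐ[volume] _
  filter_upwards [mulOp_apply u (mulOp v f), mulOp_apply v f, mulOp_apply (u * v) f] with t h1 h2 h3
  rw [h1, h2, h3]
  simp [mul_assoc]

theorem mulOp_const_sub_apply (u : C(I, ℝ)) (x : ℝ) (f : L2I) :
    mulOp (ContinuousMap.const I x - u) f = (x : ℂ) • f - mulOp u f := by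
  refine Lp.ext ?_
  filter_upwards [mulOp_apply u f, mulOp_apply (ContinuousMap.const I x - u) f,
    Lp.coeFn_sub ((x : ℂ) • f) (mulOp u f), Lp.coeFn_smul (x : ℂ) f] with t h1 h2 h3 h4
  rw [h2, h3, Pi.sub_apply, h4, h1]
  simp [sub_mul]

theorem spectrum_mulOp_subset (u : C(I, ℝ)) :
    spectrum ℂ (mulOp u) ⊆ (fun x : ℝ => (x : ℂ)) '' Set.range u := by
  intro z hz
  have hzr : z = (z.re : ℂ) := (isSelfAdjoint_mulOp u).mem_spectrum_eq_re hz
  refine ⟨z.re, ?_, hzr.symm⟩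
  by_contra hx
  have hne : ∀ t, z.re - u t ≠ 0 := fun t ht => hx ⟨t, (sub_eq_zero.1 ht).symm⟩
  let w : C(I, ℝ) := ⟨fun t => (z.re - u t)⁻¹, by fun_prop (disch := exact hne _)⟩
  have hvw : (ContinuousMap.const I z.re - u) * w = 1 := by
    ext t
    simp [w, hne t]
  have heq : algebraMap ℂ (L2I →L[ℂ] L2I) z - mulOp u =
      mulOp (ContinuousMap.const I z.re - u) := by
    ext1 f
    rw [mulOp_const_sub_apply, ← hzr]
    simp [Algebra.algebraMap_eq_smul_one]
  refine hz ?_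
  rw [spectrum.mem_resolventSet_iff, heq]
  refine isUnit_iff_exists.2 ⟨mulOp w, ?_, ?_⟩
  · rw [mulOp_mul_mulOp, hvw, mulOp_one]
  · rw [mulOp_mul_mulOp, mul_comm, hvw, mulOp_one]

/-! ### Singular sequences for the multiplication operator -/

theorem volume_pos_of_isOpen {S : Set I} (hS : IsOpen S) (hne : S.Nonempty) :
    0 < (volume : Measure I) S := by
  obtain ⟨V, hV, rfl⟩ := isOpen_induced_iff.1 hS
  obtain ⟨t, ht⟩ := hne
  have ht' : (t : ℝ) ∈ closure (Set.Ioo (0 : ℝ) 1) := by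
    rw [closure_Ioo zero_ne_one]
    exact t.2
  obtain ⟨y, hyV, hy⟩ := mem_closure_iff.1 ht' V hV ht
  rw [unitInterval.volume_apply]
  refine ((hV.inter isOpen_Ioo).measure_pos volume ⟨y, hyV, hy⟩).trans_le (measure_mono ?_)
  exact fun x hx => ⟨⟨x, Set.Ioo_subset_Icc_self hx.2⟩, hx.1, rfl⟩

/-- The sequence consists of normalised indicators of disjoint open subsets of `S`. -/
theorem exists_orthonormal_of_isOpen {S : Set I} (hS : IsOpen S) (hne : S.Nonempty) :
    ∃ f : ℕ → L2I, Orthonormal ℂ f ∧ ∀ n, ∀ᵐ t : I, t ∉ S → f n t = 0 := by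
  have hinf : Infinite S := Set.infinite_coe_iff.2 fun hfin =>
    (volume_pos_of_isOpen hS hne).ne' (hfin.measure_zero volume)
  obtain ⟨V, hVinf, hVo, hVd⟩ := exists_seq_infinite_isOpen_pairwise_disjoint S
  let T : ℕ → Set I := fun n => Subtype.val '' V n
  have hTo : ∀ n, IsOpen (T n) := fun n => hS.isOpenMap_subtype_val _ (hVo n)
  have hTpos : ∀ n, 0 < (volume : Measure I) (T n) := fun n =>
    volume_pos_of_isOpen (hTo n) ((hVinf n).nonempty.image _)
  have hTd : ∀ n m, n ≠ m → T n ∩ T m = ∅ := fun n m hnm =>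
    Set.disjoint_iff_inter_eq_empty.1 ((Set.disjoint_image_iff Subtype.val_injective).2 (hVd hnm))
  let g : ℕ → L2I := fun n =>
    indicatorConstLp 2 (hTo n).measurableSet (measure_ne_top volume (T n)) 1
  have hg0 : ∀ n, ‖g n‖ ≠ 0 := fun n => by
    rw [norm_indicatorConstLp (by norm_num) (by norm_num)]
    have : 0 < volume.real (T n) := ENNReal.toReal_pos (hTpos n).ne' (measure_ne_top _ _)
    simp only [norm_one, one_mul]
    positivity
  refine ⟨fun n => ((‖g n‖⁻¹ : ℝ) : ℂ) • g n, ⟨fun n => ?_, fun n m hnm => ?_⟩, fun n => ?_⟩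
  · rw [norm_smul]
    simp [hg0 n]
  · change inner ℂ (_ • g n) (_ • g m) = 0
    rw [inner_smul_left, inner_smul_right, L2.inner_indicatorConstLp_indicatorConstLp]
    simp [hTd n m hnm]
  · filter_upwards [Lp.coeFn_smul ((‖g n‖⁻¹ : ℝ) : ℂ) (g n), indicatorConstLp_coeFn_notMem
      (p := 2) (hs := (hTo n).measurableSet) (hμs := measure_ne_top volume (T n)) (c := (1 : ℂ))]
      with t h1 h2 htS
    have h3 : t ∉ T n := fun ⟨s, _, hs⟩ => htS (hs ▸ s.2)
    rw [h1, Pi.smul_apply]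
    simp [g, h2 h3]

theorem exists_orthonormal_norm_mulOp_sub_le (u : C(I, ℝ)) (t₀ : I) {ε : ℝ} (hε : 0 < ε) :
    ∃ f : ℕ → L2I, Orthonormal ℂ f ∧ ∀ n, ‖mulOp u (f n) - (u t₀ : ℂ) • f n‖ ≤ ε := by
  have hS : IsOpen {t | |u t₀ - u t| < ε} := isOpen_lt (by fun_prop) continuous_const
  obtain ⟨f, hf, hfS⟩ := exists_orthonormal_of_isOpen hS ⟨t₀, by simpa using hε⟩
  refine ⟨f, hf, fun n => ?_⟩
  rw [norm_sub_rev, ← mulOp_const_sub_apply]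
  have h : ‖mulOp (ContinuousMap.const I (u t₀) - u) (f n)‖ ≤ ε * ‖f n‖ := by
    refine Lp.norm_le_mul_norm_of_ae_le_mul ?_
    filter_upwards [mulOp_apply (ContinuousMap.const I (u t₀) - u) (f n), hfS n] with t h1 h2
    rw [h1, norm_mul, Complex.norm_real]
    by_cases ht : |u t₀ - u t| < ε
    · exact mul_le_mul_of_nonneg_right ht.le (norm_nonneg _)
    · simp [h2 ht]
  rwa [hf.1 n, mul_one] at h

theorem range_eq_Icc {u : C(I, ℝ)} (hu : ∀ t, 0 ≤ u t) (hu0 : ∃ t, u t = 0) :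
    Set.range u = Set.Icc 0 (⨆ t, u t) := by
  have hbdd : BddAbove (Set.range u) := (isCompact_range u.continuous).bddAbove
  refine Set.Subset.antisymm ?_ fun x hx => ?_
  · rintro _ ⟨t, rfl⟩
    exact ⟨hu t, le_ciSup hbdd t⟩
  · obtain ⟨t₀, ht₀⟩ := hu0
    obtain ⟨t₁, ht₁⟩ := (isCompact_range u.continuous).sSup_mem (Set.range_nonempty u)
    exact mem_range_of_exists_le_of_exists_ge u.continuous ⟨t₀, ht₀.trans_le hx.1⟩
      ⟨t₁, hx.2.trans_eq ht₁.symm⟩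

end Friedrichs

theorem mainTheorem1 (u : C(unitInterval, ℝ)) (hu : ∀ t, 0 ≤ u t) (hu0 : ∃ t, u t = 0)
    (k : Friedrichs.L2Sq)
    (hk : ∀ᵐ p : unitInterval × unitInterval, k p = conj (k (p.2, p.1))) :
    Friedrichs.essentialSpectrum (Friedrichs.hamiltonian u k) =
        (fun x : ℝ => (x : ℂ)) '' Set.Icc 0 (⨆ t, u t) ∧
      ({x : ℝ | 0 < x ∧ Friedrichs.IsEigenvalue (Friedrichs.integralOp k) (x : ℂ)}.Finite →
        Friedrichs.FinitelyManyEigenvaluesIn (Friedrichs.hamiltonian u k)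
          (Friedrichs.belowEssentialSpectrum (Friedrichs.hamiltonian u k))) ∧
      ({x : ℝ | x < 0 ∧ Friedrichs.IsEigenvalue (Friedrichs.integralOp k) (x : ℂ)}.Finite →
        Friedrichs.FinitelyManyEigenvaluesIn (Friedrichs.hamiltonian u k)
          (Friedrichs.aboveEssentialSpectrum (Friedrichs.hamiltonian u k))) := by
  open Friedrichs in
  have hU := isSelfAdjoint_mulOp u
  have hKs := isSelfAdjoint_integralOp hk
  have hK := isCompactOperator_integralOp k
  have hrange := range_eq_Icc hu hu0
  have hess : essentialSpectrum (hamiltonian u k) =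
      (fun x : ℝ => (x : ℂ)) '' Set.Icc 0 (⨆ t, u t) := by
    rw [← hrange]
    refine Set.Subset.antisymm
      ((essentialSpectrum_sub_subset hU hKs hK).trans (spectrum_mulOp_subset u)) ?_
    rintro _ ⟨_, ⟨t, rfl⟩, rfl⟩
    exact mem_essentialSpectrum_sub_of_orthonormal hU hKs hK fun ε hε =>
      exists_orthonormal_norm_mulOp_sub_le u t hε
  have hmax : ∀ t, u t ≤ ⨆ t, u t := fun t => (hrange.subset (Set.mem_range_self t)).2
  obtain ⟨t₀, ht₀⟩ := hu0
  have hmax0 : 0 ≤ ⨆ t, u t := (hu t₀).trans (hmax t₀)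
  refine ⟨hess, fun hfin => ?_, fun hfin => ?_⟩
  · refine (finitelyManyEigenvaluesIn_sub hU hKs hK (c := 0)
      (mul_norm_sq_le_re_inner_mulOp hu) hfin).mono fun x hx => ?_
    simpa using hx 0 (hess ▸ ⟨0, Set.left_mem_Icc.2 hmax0, Complex.ofReal_zero⟩)
  · -- apply the bound from below to `-H = (-U) - (-K)`
    have h := finitelyManyEigenvaluesIn_sub (c := -⨆ t, u t) hU.neg hKs.neg hK.neg ?_ ?_
    · refine FinitelyManyEigenvaluesIn.of_neg ?_
      have hH : -mulOp u - -integralOp k = -hamiltonian u k := by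
        rw [hamiltonian]
        abel
      rw [hH] at h
      refine h.mono fun x hx => ?_
      have := hx ((⨆ t, u t : ℝ) : ℂ) (hess ▸ ⟨_, Set.right_mem_Icc.2 hmax0, rfl⟩)
      rw [Complex.ofReal_re] at this
      exact lt_neg_of_lt_neg this
    · rw [← mulOp_neg]
      exact mul_norm_sq_le_re_inner_mulOp fun t => neg_le_neg (hmax t)
    · convert hfin.neg using 1
      ext x
      simp [isEigenvalue_neg_iff]
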